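/- Let $P$ be a finite set (of qubits), let $V=\mathbb F_2\oplus\mathbb F_2$ with standard base $(z,x)$ and its symplectic form $\omega$, and equip $V^P$ with the sum of the forms $\omega$ over the factors. For $S\subset P$ identify $V^S$ with the vectors of $V^P$ that vanish outside $S$, and for a subspace $L\subset V^P$ put $L_S=L\cap V^S$; say that $L$ splits off $L_S$ if $L=L_S\times L_{P\setminus S}$ (the case $S=P$ is allowed). A factor $L_S$ with $S\neq\emptyset$ is a zero factor if $L_S=0$; it is a Bell Lagrangian if $|S|=2$ and $L_S$ is a Lagrangian subspace of $V^S$ (isotropic of dimension $2$) which is indecomposable, that is, $L_S\neq L_T\times L_{S\setminus T}$ for all $T\subset S$ with $\emptyset\neq T\neq S$. The Pauli group $\tilde V^P$ consists of all operators $\lambda\bigotimes_{s\in P}E(v_s)$ on $(\mathbb C^2)^{\otimes P}$ with $|\lambda|=1$ and $v\in V^P$, where $E(0)=1$, $E(z)=Z$, $E(x)=X$, $E(z+x)=Y$; it projects to $V^P$ by sending this operator to $v$. Let $L\subset V^P$ be an isotropic subspace. For a homomorphic section $\sigma\colon L\to\tilde V^P$ of this projection over $L$ let $C(L,\sigma)\subset(\mathbb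 C^2)^{\otimes P}$ be the common fixed space of the operators in $\sigma(L)$. Identify $U(2)/S^1=SO(3)$ by conjugation on the traceless Hermitian $2\times2$ matrices with base $X,Y,Z$, and let $$A(L,\sigma)=\Bigl\{g\in SO(3)^P \;\Big|\; \bigl(\textstyle\bigotimes_{s}\tilde g_s\bigr)\,C(L,\sigma)\subset C(L,\sigma)\text{ for some }\tilde g\in U(2)^P\text{ representing }g\Bigr\}.$$ For $p\in P$ let $A(L,\sigma)_p\subset SO(3)$ be the projection of $A(L,\sigma)$ to the $p$-th factor. The octahedral group is the subgroup of $SO(3)$ generated by the rotations by a right angle around the $x$, $y$ and $z$ axes; for $a\in\{x,y,z\}$ the infinite dihedral group $D_a\subset SO(3)$ is generated by all rotations around the $a$ axis and one rotation by $180$ degrees around an orthogonal coordinate axis. **Theorem.** Let $L\subset V^P$ be an isotropic subspace that splits off neither a zero factor nor a Bell Lagrangian. Then for each $p\in P$ at least one of the following statements is true: 1. $A(L,\sigma)_p$ is contained in the octahedral group for every section $\sigma$ over $L$; 2. there is an $a\in\{x,y,z\}$ such that $A(L,\sigma)_p$ is contained in the dihedral group $D_a$ for every section $\sigma$ over $L$.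 -/

import Mathlib

open scoped TensorProduct

namespace StabilizerCode

/-- The symplectic plane `V = 𝔽₂ ⊕ 𝔽₂`; the standard base is `z = (1, 0)`, `x = (0, 1)`. -/
abbrev V : Type := ZMod 2 × ZMod 2

section Symplectic

variable {P : Type*} [Fintype P] [DecidableEq P]

/-- The symplectic form on `V ^ P` (in characteristic two, so the sign is immaterial). -/
def omega (v w : P → V) : ZMod 2 :=
  ∑ s, ((v s).1 * (w s).2 - (v s).2 * (w s).1)

/-- The form `omega` vanishes identically on `L × L`. -/
def IsIsotropic (L : Submodule (ZMod 2) (P → V)) : Prop :=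
  ∀ v ∈ L, ∀ w ∈ L, omega v w = 0

/-- `V ^ S` as the subspace of `V ^ P` of the vectors that vanish outside `S`. -/
def coordSubspace (S : Finset P) : Submodule (ZMod 2) (P → V) where
  carrier := {v | ∀ p, p ∉ S → v p = 0}
  add_mem' := by
    intro v w hv hw p hp
    simp [hv p hp, hw p hp]
  zero_mem' := by
    intro p _
    rfl
  smul_mem' := by
    intro c v hv p hp
    simp [hv p hp]

/-- `L_S = L ∩ V ^ S`. -/
def restrict (L : Submodule (ZMod 2) (P → V)) (S : Finset P) :
    Submodule (ZMod 2) (P → V) :=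
  L ⊓ coordSubspace S

/-- `L` splits as the direct product `L_S × L_{P ∖ S}`. -/
def SplitsAt (L : Submodule (ZMod 2) (P → V)) (S : Finset P) : Prop :=
  L = restrict L S ⊔ restrict L Sᶜ

/-- `L` splits off a zero factor: `L = L_S × L_{P ∖ S}` with `S ≠ ∅` and `L_S = 0`
(the case `S = P`, `L = 0` included). -/
def SplitsOffZero (L : Submodule (ZMod 2) (P → V)) : Prop :=
  ∃ S : Finset P, S.Nonempty ∧ SplitsAt L S ∧ restrict L S = ⊥

/-- `M` is a Lagrangian subspace of `V ^ S`. -/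
def IsLagrangianOn (S : Finset P) (M : Submodule (ZMod 2) (P → V)) : Prop :=
  M ≤ coordSubspace S ∧ IsIsotropic M ∧ Module.finrank (ZMod 2) M = S.card

/-- `M`, a subspace of `V ^ S`, is indecomposable: `M ≠ M_T × M_{S ∖ T}` for all
`T ⊆ S` with `∅ ≠ T ≠ S`. -/
def IsIndecomposableOn (S : Finset P) (M : Submodule (ZMod 2) (P → V)) : Prop :=
  ∀ T ⊆ S, T.Nonempty → T ≠ S → M ≠ restrict M T ⊔ restrict M (S \ T)

/-- `M` is a Bell Lagrangian on `S`: an indecomposable Lagrangian in `V ^ S`, `|S| = 2`. -/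
def IsBellOn (S : Finset P) (M : Submodule (ZMod 2) (P → V)) : Prop :=
  S.card = 2 ∧ IsLagrangianOn S M ∧ IsIndecomposableOn S M

/-- `L` splits off a Bell Lagrangian. -/
def SplitsOffBell (L : Submodule (ZMod 2) (P → V)) : Prop :=
  ∃ S : Finset P, SplitsAt L S ∧ IsBellOn S (restrict L S)

end Symplectic

section Operators

/-- The three Pauli matrices `X, Y, Z`, indexed by the coordinate axes `x, y, z` of `ℝ³`. -/
def sigma : Fin 3 → Matrix (Fin 2) (Fin 2) ℂ :=
  ![!![0, 1; 1, 0], !![0, -Complex.I; Complex.I, 0], !![1, 0; 0, -1]]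

/-- The Pauli matrix of a vector of `V`: `0 ↦ 1`, `z ↦ Z`, `x ↦ X`, `z + x ↦ Y`. -/
def pauli (v : V) : Matrix (Fin 2) (Fin 2) ℂ :=
  if v = (0, 0) then 1 else if v = (1, 0) then sigma 2
  else if v = (0, 1) then sigma 0 else sigma 1

/-- The state space `(ℂ²)^{⊗ P}`. -/
abbrev StateSpace (P : Type*) : Type _ := ⨂[ℂ] _ : P, (Fin 2 → ℂ)

/-- The operator `⨂ₛ Aₛ` on the state space. -/
noncomputable def localOp {P : Type*} (A : P → Matrix (Fin 2) (Fin 2) ℂ) :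
    Module.End ℂ (StateSpace P) :=
  PiTensorProduct.map fun s => Matrix.toLin' (A s)

/-- `T` is an element of the Pauli group that projects to `v ∈ V ^ P`: a product of the
tensor product of Pauli matrices given by `v` with a scalar of modulus one. -/
def IsPauliOver {P : Type*} (v : P → V) (T : Module.End ℂ (StateSpace P)) : Prop :=
  ∃ c : Circle, T = (c : ℂ) • localOp fun s => pauli (v s)

/-- A homomorphic section over `L` of the projection from the Pauli group to `V ^ P`. -/
structure StabSection {P : Type*} (L : Submodule (ZMod 2) (P → V)) where
  /-- the underlying homomorphism -/
  hom : Multiplicative L →* Module.End ℂ (StateSpace P)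
  isPauliOver : ∀ v : L, IsPauliOver (v : P → V) (hom (Multiplicative.ofAdd v))

/-- The stabilizer code `C(L, σ)`: the common fixed space of the stabilizer group `σ(L)`. -/
noncomputable def code {P : Type*} {L : Submodule (ZMod 2) (P → V)} (σ : StabSection L) :
    Submodule ℂ (StateSpace P) :=
  ⨅ v : Multiplicative L, LinearMap.ker (σ.hom v - 1)

/-- The rotation group `SO(3)`. -/
abbrev SO3 : Type := Matrix.specialOrthogonalGroup (Fin 3) ℝ

/-- The traceless Hermitian operator `r₀ X + r₁ Y + r₂ Z`. -/
noncomputable def herm (r : Fin 3 → ℝ) : Matrix (Fin 2) (Fin 2) ℂ :=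
  ∑ i, (r i : ℂ) • sigma i

/-- `u ∈ U(2)` represents `R ∈ SO(3) = U(2) / S¹`: conjugation by `u` on the traceless
Hermitian operators is `R`. -/
def Represents (u : Matrix.unitaryGroup (Fin 2) ℂ) (R : SO3) : Prop :=
  ∀ r : Fin 3 → ℝ, (u : Matrix (Fin 2) (Fin 2) ℂ) * herm r * star (u : Matrix (Fin 2) (Fin 2) ℂ)
    = herm ((R : Matrix (Fin 3) (Fin 3) ℝ).mulVec r)

theorem Represents.one : Represents 1 1 := by
  intro r
  simp

theorem Represents.mul {u w : Matrix.unitaryGroup (Fin 2) ℂ} {R T : SO3}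
    (hu : Represents u R) (hw : Represents w T) : Represents (u * w) (R * T) := by
  intro r
  have h := hu ((T : Matrix (Fin 3) (Fin 3) ℝ).mulVec r)
  rw [← hw r] at h
  simpa [Matrix.mul_assoc, Matrix.mulVec_mulVec] using h

theorem Represents.inv {u : Matrix.unitaryGroup (Fin 2) ℂ} {R : SO3}
    (hu : Represents u R) : Represents u⁻¹ R⁻¹ := by
  intro r
  have h := hu (((R⁻¹ : SO3) : Matrix (Fin 3) (Fin 3) ℝ).mulVec r)
  have hR : (R : Matrix (Fin 3) (Fin 3) ℝ) * ((R⁻¹ : SO3) : Matrix (Fin 3) (Fin 3) ℝ) =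
      1 :=
    congrArg Subtype.val (mul_inv_cancel R)
  rw [Matrix.mulVec_mulVec, hR, Matrix.one_mulVec] at h
  rw [← h]
  have h1 : star (u : Matrix (Fin 2) (Fin 2) ℂ) * u = 1 := Matrix.UnitaryGroup.star_mul_self u
  have h2 : ((u⁻¹ : Matrix.unitaryGroup (Fin 2) ℂ) : Matrix (Fin 2) (Fin 2) ℂ)
      = star (u : Matrix (Fin 2) (Fin 2) ℂ) := rfl
  rw [h2, star_star]
  calc _ = (star (u : Matrix (Fin 2) (Fin 2) ℂ) * u) * herm (((R⁻¹ : SO3) : Matrix (Fin 3) (Fin 3) ℝ).mulVec r) *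
        (star (u : Matrix (Fin 2) (Fin 2) ℂ) * u) := by simp only [Matrix.mul_assoc]
    _ = _ := by rw [h1, Matrix.one_mul, Matrix.mul_one]

theorem localOp_one {P : Type*} : localOp (fun _ : P => 1) = 1 := by
  simp only [localOp, Matrix.toLin'_one]
  exact PiTensorProduct.map_id

theorem localOp_mul {P : Type*} (A B : P → Matrix (Fin 2) (Fin 2) ℂ) :
    localOp (fun s => A s * B s) = localOp A * localOp B := by
  simp only [localOp, Matrix.toLin'_mul]
  exact PiTensorProduct.map_comp _ _

variable {P : Type*} [Fintype P]

/-- The local unitary operator `⨂ₛ uₛ` sends the code into itself. -/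
def Preserves {L : Submodule (ZMod 2) (P → V)} (σ : StabSection L)
    (u : P → Matrix.unitaryGroup (Fin 2) ℂ) : Prop :=
  ∀ ψ ∈ code σ, localOp (fun s => (u s : Matrix (Fin 2) (Fin 2) ℂ)) ψ ∈ code σ

theorem Preserves.inv {L : Submodule (ZMod 2) (P → V)} {σ : StabSection L}
    {u : P → Matrix.unitaryGroup (Fin 2) ℂ} (h : Preserves σ u) : Preserves σ u⁻¹ := by
  set T := localOp (fun s => (u s : Matrix (Fin 2) (Fin 2) ℂ)) with hT
  set T' := localOp (fun s => ((u⁻¹) s : Matrix (Fin 2) (Fin 2) ℂ)) with hT'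
  have hl : T' * T = 1 := by
    rw [hT, hT', ← localOp_mul, ← localOp_one]
    congr 1
    funext s
    exact Matrix.UnitaryGroup.star_mul_self (u s)
  have hli : ∀ ψ, T' (T ψ) = ψ := fun ψ => by
    have := LinearMap.congr_fun hl ψ
    simpa using this
  have hinj : Function.Injective (T.restrict h) := by
    intro a b hab
    apply Subtype.ext
    rw [← hli a, ← hli b]
    exact congrArg T' (congrArg Subtype.val hab)
  have hsurj : Function.Surjective (T.restrict h) :=
    LinearMap.injective_iff_surjective (V := code σ).1 hinj
  intro ψ hψ
  obtain ⟨φ, hφ⟩ := hsurj ⟨ψ, hψ⟩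
  have : ψ = T φ := (congrArg Subtype.val hφ).symm
  rw [this]
  change T' (T φ) ∈ code σ
  rw [hli]
  exact φ.2

/-- The automorphism group `A(L, σ) ⊆ SO(3) ^ P` of the code. -/
def autGroup {L : Submodule (ZMod 2) (P → V)} (σ : StabSection L) : Subgroup (P → SO3) where
  carrier := {g | ∃ u : P → Matrix.unitaryGroup (Fin 2) ℂ,
    (∀ s, Represents (u s) (g s)) ∧ Preserves σ u}
  mul_mem' := by
    rintro g h ⟨u, hu, hu'⟩ ⟨w, hw, hw'⟩
    refine ⟨u * w, fun s => (hu s).mul (hw s), fun ψ hψ => ?_⟩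
    have := hu' _ (hw' ψ hψ)
    rw [← Module.End.mul_apply, ← localOp_mul] at this
    exact this
  one_mem' := by
    refine ⟨1, fun s => Represents.one, fun ψ hψ => ?_⟩
    have : localOp (fun s : P => ((1 : P → Matrix.unitaryGroup (Fin 2) ℂ) s :
        Matrix (Fin 2) (Fin 2) ℂ)) = 1 := localOp_one
    rw [this]
    exact hψ
  inv_mem' := by
    rintro g ⟨u, hu, hu'⟩
    exact ⟨u⁻¹, fun s => (hu s).inv, hu'.inv⟩

/-- The automorphism group at the qubit `p`: the projection of `A(L, σ)` to the `p`-th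
factor `SO(3)`. -/
def autGroupAt {L : Submodule (ZMod 2) (P → V)} (σ : StabSection L) (p : P) : Subgroup SO3 :=
  (autGroup σ).map (Pi.evalMonoidHom (fun _ : P => SO3) p)

end Operators

section Rotations

/-- The matrix of the rotation by the angle `θ` around the coordinate axis `a`
(`0, 1, 2` stand for `x, y, z`). -/
noncomputable def rotMatrix (a : Fin 3) (θ : ℝ) : Matrix (Fin 3) (Fin 3) ℝ :=
  ![!![1, 0, 0; 0, Real.cos θ, -Real.sin θ; 0, Real.sin θ, Real.cos θ],
    !![Real.cos θ, 0, Real.sin θ; 0, 1, 0; -Real.sin θ, 0, Real.cos θ],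
    !![Real.cos θ, -Real.sin θ, 0; Real.sin θ, Real.cos θ, 0; 0, 0, 1]] a

theorem rotMatrix_mem (a : Fin 3) (θ : ℝ) :
    rotMatrix a θ ∈ Matrix.specialOrthogonalGroup (Fin 3) ℝ := by
  have h := Real.sin_sq_add_cos_sq θ
  rw [Matrix.mem_specialOrthogonalGroup_iff, Matrix.mem_orthogonalGroup_iff]
  constructor
  · ext i j
    fin_cases a <;> fin_cases i <;> fin_cases j <;>
      simp [rotMatrix, Matrix.mul_apply, Fin.sum_univ_three] <;>
      nlinarith
  · fin_cases a <;> simp [rotMatrix, Matrix.det_fin_three] <;> nlinarith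

/-- The rotation by the angle `θ` around the coordinate axis `a`. -/
noncomputable def rot (a : Fin 3) (θ : ℝ) : SO3 := ⟨rotMatrix a θ, rotMatrix_mem a θ⟩

/-- The octahedral group, generated by the rotations by a right angle around the
coordinate axes. -/
noncomputable def octahedralGroup : Subgroup SO3 :=
  Subgroup.closure (Set.range fun a : Fin 3 => rot a (Real.pi / 2))

/-- The infinite dihedral group `D_a`, generated by all rotations around the axis `a` and
the rotation by 180 degrees around the next coordinate axis (in cyclic order), which is
orthogonal to `a`. -/
noncomputable def dihedralGroup (a : Fin 3) : Subgroup SO3 :=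
  Subgroup.closure (Set.range (rot a) ∪ {rot (a + 1) Real.pi})

end Rotations

end StabilizerCode

/-! The sum `Q` of the stabilizer operators is `|L|` times the projector onto the code, and a local
unitary that preserves the code commutes with it (`Preserves.commute`). Expanded in Pauli operators,
`Q` is a tensor with nonzero coefficients exactly on `L`, and it is invariant under the product of
the matrices `1 ⊕ g s` (`exists_invariant_coeff`). These matrices respect supports, so each support
can be studied alone.

As no zero factor splits off, some `v ∈ L` has minimal support `S` among the supports containing
`p`. If all vectors of `L` with support `S` have the same entry at `p`, the part of `Q` with support
`S` is a product of this entry with a tensor in the other factors. Hence `g p` preserves the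
corresponding axis, which gives the dihedral case.

Otherwise minimality forces every nonzero vector of `L_S` to have full support in `S`, and each
coordinate in `S` identifies `L_S` with `V`. Isotropy makes `|S|` even, and `|S| = 2` would split
off a Bell Lagrangian, so `|S| ≥ 4`. Contracting `Q` at `p` turns a pure tensor into a combination
of the tensors of the vectors of `L_S`. With at least two factors left, a pure tensor allows only
one term, so `g p` is monomial (`adjointEntry_monomial`), hence octahedral. -/

namespace StabilizerCode

/-! ### Rotations in the dihedral and octahedral groups. -/

section Rotations

theorem SO3.sum_mul_col (g : SO3) (i j : Fin 3) :
    ∑ k, g.1 k i * g.1 k j = if i = j then 1 else 0 := by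
  have h := (Matrix.mem_specialOrthogonalGroup_iff.mp g.2).1
  rw [Matrix.mem_orthogonalGroup_iff'] at h
  have := congrFun (congrFun h i) j
  simpa [Matrix.mul_apply, Matrix.one_apply] using this

theorem SO3.sum_mul_row (g : SO3) (i j : Fin 3) :
    ∑ k, g.1 i k * g.1 j k = if i = j then 1 else 0 := by
  have h := (Matrix.mem_specialOrthogonalGroup_iff.mp g.2).1
  rw [Matrix.mem_orthogonalGroup_iff] at h
  have := congrFun (congrFun h i) j
  simpa [Matrix.mul_apply, Matrix.one_apply] using this

theorem exists_cos_sin {a b : ℝ} (h : a ^ 2 + b ^ 2 = 1) :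
    ∃ θ : ℝ, Real.cos θ = a ∧ Real.sin θ = b := by
  have hn : ‖(⟨a, b⟩ : ℂ)‖ = 1 := by
    rw [Complex.norm_def, Complex.normSq_mk, ← sq, ← sq, h, Real.sqrt_one]
  have h0 : (⟨a, b⟩ : ℂ) ≠ 0 := by
    intro h0
    simp [h0] at hn
  refine ⟨Complex.arg ⟨a, b⟩, ?_, ?_⟩
  · rw [Complex.cos_arg h0, hn, div_one]
  · rw [Complex.sin_arg, hn, div_one]

/-- Equality case of Cauchy–Schwarz: for unit columns, `(A - D)² + (B + C)²` is two minus twice the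
determinant. -/
theorem exists_planar_rotation {A B C D : ℝ} (h1 : A ^ 2 + C ^ 2 = 1) (h2 : B ^ 2 + D ^ 2 = 1)
    (h3 : A * D - B * C = 1) :
    ∃ θ : ℝ, A = Real.cos θ ∧ B = -Real.sin θ ∧ C = Real.sin θ ∧ D = Real.cos θ := by
  obtain ⟨θ, hc, hs⟩ := exists_cos_sin h1
  have h4 : (A - D) ^ 2 + (B + C) ^ 2 = 0 := by linear_combination h1 + h2 - 2 * h3
  have h5 : A - D = 0 := by nlinarith [sq_nonneg (A - D), sq_nonneg (B + C)]
  have h6 : B + C = 0 := by nlinarith [sq_nonneg (A - D), sq_nonneg (B + C)]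
  exact ⟨θ, hc.symm, by linarith, hs.symm, by linarith⟩

/-- A rotation that fixes the coordinate axis `a` pointwise is a rotation around `a`. -/
theorem SO3.exists_eq_rot (g : SO3) (a : Fin 3) (h : g.1 a a = 1) : ∃ θ, g = rot a θ := by
  have hdet : g.1.det = 1 := (Matrix.mem_specialOrthogonalGroup_iff.mp g.2).2
  have hc := g.sum_mul_col
  have hr := g.sum_mul_row a a
  rw [Matrix.det_fin_three] at hdet
  simp only [Fin.sum_univ_three] at hc hr
  have hca := hc a a
  have c0 := hc 0 0
  have c1 := hc 1 1
  have c2 := hc 2 2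
  have vanish : ∀ x y : ℝ, x * x + y * y = 0 → x = 0 ∧ y = 0 := fun x y h =>
    ⟨by nlinarith [sq_nonneg x, sq_nonneg y], by nlinarith [sq_nonneg x, sq_nonneg y]⟩
  fin_cases a
  · simp only [Fin.zero_eta, Fin.isValue, if_true] at h hr hca c0 c1 c2
    rw [h] at hr hca hdet
    obtain ⟨h1, h2⟩ := vanish (g.1 1 0) (g.1 2 0) (by linarith)
    obtain ⟨h3, h4⟩ := vanish (g.1 0 1) (g.1 0 2) (by linarith)
    rw [h1, h2, h3, h4] at hdet
    rw [h3] at c1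
    rw [h4] at c2
    obtain ⟨θ, e1, e2, e3, e4⟩ := exists_planar_rotation (A := g.1 1 1) (B := g.1 1 2)
      (C := g.1 2 1) (D := g.1 2 2) (by linarith) (by linarith) (by linarith)
    refine ⟨θ, Subtype.ext (Matrix.ext fun i j => ?_)⟩
    fin_cases i <;> fin_cases j <;> simp [rot, rotMatrix, h, h1, h2, h3, h4, e1, e2, e3, e4]
  · simp only [Fin.mk_one, Fin.isValue, if_true] at h hr hca c0 c1 c2
    rw [h] at hr hca hdet
    obtain ⟨h1, h2⟩ := vanish (g.1 0 1) (g.1 2 1) (by linarith)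
    obtain ⟨h3, h4⟩ := vanish (g.1 1 0) (g.1 1 2) (by linarith)
    rw [h1, h2, h3, h4] at hdet
    rw [h3] at c0
    rw [h4] at c2
    obtain ⟨θ, e1, e2, e3, e4⟩ := exists_planar_rotation (A := g.1 2 2) (B := g.1 2 0)
      (C := g.1 0 2) (D := g.1 0 0) (by linarith) (by linarith) (by linarith)
    refine ⟨θ, Subtype.ext (Matrix.ext fun i j => ?_)⟩
    fin_cases i <;> fin_cases j <;> simp [rot, rotMatrix, h, h1, h2, h3, h4, e1, e2, e3, e4]
  · simp only [Fin.reduceFinMk, Fin.isValue, if_true] at h hr hca c0 c1 c2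
    rw [h] at hr hca hdet
    obtain ⟨h1, h2⟩ := vanish (g.1 0 2) (g.1 1 2) (by linarith)
    obtain ⟨h3, h4⟩ := vanish (g.1 2 0) (g.1 2 1) (by linarith)
    rw [h1, h2, h3, h4] at hdet
    rw [h3] at c0
    rw [h4] at c1
    obtain ⟨θ, e1, e2, e3, e4⟩ := exists_planar_rotation (A := g.1 0 0) (B := g.1 0 1)
      (C := g.1 1 0) (D := g.1 1 1) (by linarith) (by linarith) (by linarith)
    refine ⟨θ, Subtype.ext (Matrix.ext fun i j => ?_)⟩
    fin_cases i <;> fin_cases j <;> simp [rot, rotMatrix, h, h1, h2, h3, h4, e1, e2, e3, e4]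

/-- In a column of a rotation with a single nonzero entry, this entry is `1` or `-1`. -/
theorem SO3.entry_eq_one_or (g : SO3) (i a : Fin 3) (h : ∀ j, j ≠ i → g.1 j a = 0) :
    g.1 i a = 1 ∨ g.1 i a = -1 := by
  have := g.sum_mul_col a a
  rw [Finset.sum_eq_single i (fun j _ hj => by rw [h j hj, zero_mul]) (by simp), if_pos rfl] at this
  exact mul_self_eq_one_iff.mp this

/-- A rotation that preserves the axis `a` is in the dihedral group `D_a`. -/
theorem mem_dihedralGroup (g : SO3) (a : Fin 3) (h : ∀ j, j ≠ a → g.1 j a = 0) :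
    g ∈ dihedralGroup a := by
  have hrot : ∀ θ, rot a θ ∈ dihedralGroup a := fun θ =>
    Subgroup.subset_closure (Or.inl ⟨θ, rfl⟩)
  have hflip : rot (a + 1) Real.pi ∈ dihedralGroup a := Subgroup.subset_closure (Or.inr rfl)
  rcases g.entry_eq_one_or a a h with h1 | h1
  · obtain ⟨θ, rfl⟩ := g.exists_eq_rot a h1
    exact hrot θ
  -- The half-turn around the axis `a + 1` reverses the axis `a`, which reduces to the case of entry
  -- `1`.
  · rw [← Subgroup.mul_mem_cancel_left _ hflip]
    obtain ⟨θ, hθ⟩ := SO3.exists_eq_rot (rot (a + 1) Real.pi * g) a (by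
      change (rotMatrix (a + 1) Real.pi * g.1) a a = 1
      rw [Matrix.mul_apply, Finset.sum_eq_single a (fun j _ hj => by rw [h j hj, mul_zero])
        (by simp), h1]
      fin_cases a <;> simp [rotMatrix])
    rw [hθ]
    exact hrot θ

theorem rot_mem_octahedralGroup (a : Fin 3) : rot a (Real.pi / 2) ∈ octahedralGroup :=
  Subgroup.subset_closure ⟨a, rfl⟩

/-- Every column of the matrix of `g` has at most one nonzero entry. -/
def SO3.IsMonomial (g : SO3) : Prop :=
  ∀ a i j, i ≠ j → g.1 i a = 0 ∨ g.1 j a = 0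

/-- A quarter turn permutes the rows up to sign. -/
theorem SO3.IsMonomial.rot_mul {g : SO3} (hg : g.IsMonomial) (b : Fin 3) :
    (rot b (Real.pi / 2) * g).IsMonomial := by
  intro a
  have h01 := hg a 0 1 (by decide)
  have h02 := hg a 0 2 (by decide)
  have h12 := hg a 1 2 (by decide)
  have key : ∀ i, (rot b (Real.pi / 2) * g).1 i a =
      ∑ k, rotMatrix b (Real.pi / 2) i k * g.1 k a := fun i => Matrix.mul_apply
  intro i j hij
  rw [key, key]
  fin_cases b <;> fin_cases i <;> fin_cases j <;>
    simp [rotMatrix, Fin.sum_univ_three] at hij ⊢ <;> tauto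

theorem SO3.IsMonomial.mem_of_one {g : SO3} (hg : g.IsMonomial) (h : g.1 0 0 = 1) :
    g ∈ octahedralGroup := by
  obtain ⟨θ, rfl⟩ := g.exists_eq_rot 0 h
  have hr := rot_mem_octahedralGroup 0
  -- The column `(0, cos θ, sin θ)` is monomial only if `cos θ` or `sin θ` vanishes, so the rotation
  -- is a power of the quarter turn.
  have h12 := hg 1 1 2 (by decide)
  simp only [rot, rotMatrix] at h12
  simp at h12
  have hcs := Real.sin_sq_add_cos_sq θ
  have hpow : ∀ n : ℕ, Real.cos (n * (Real.pi / 2)) = Real.cos θ →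
      Real.sin (n * (Real.pi / 2)) = Real.sin θ → rot 0 θ ∈ octahedralGroup := by
    intro n hc hs
    have hn : ∀ m : ℕ, rot 0 (Real.pi / 2) ^ m = rot 0 (m * (Real.pi / 2)) := by
      intro m
      induction m with
      | zero =>
        refine Subtype.ext (Matrix.ext fun i j => ?_)
        fin_cases i <;> fin_cases j <;> simp [rot, rotMatrix]
      | succ m ih =>
        rw [pow_succ, ih]
        refine Subtype.ext ?_
        change rotMatrix 0 _ * rotMatrix 0 _ = rotMatrix 0 _
        ext i j
        push_cast
        fin_cases i <;> fin_cases j <;>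
          simp [rotMatrix, Matrix.mul_apply, Fin.sum_univ_three, add_mul, Real.cos_add,
            Real.sin_add]
    have : rot 0 θ = rot 0 (Real.pi / 2) ^ n := by
      rw [hn]
      refine Subtype.ext ?_
      simp [rot, rotMatrix, hc, hs]
    rw [this]
    exact Subgroup.pow_mem _ hr n
  rcases h12 with hc | hs
  · have : Real.sin θ = 1 ∨ Real.sin θ = -1 := by
      exact mul_self_eq_one_iff.mp (by nlinarith)
    rcases this with hs | hs
    · exact hpow 1 (by simp [hc]) (by simp [hs])
    · refine hpow 3 ?_ ?_
      · rw [hc, show ((3 : ℕ) : ℝ) * (Real.pi / 2) = Real.pi / 2 + Real.pi by push_cast; ring,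
          Real.cos_add_pi, Real.cos_pi_div_two, neg_zero]
      · rw [hs, show ((3 : ℕ) : ℝ) * (Real.pi / 2) = Real.pi / 2 + Real.pi by push_cast; ring,
          Real.sin_add_pi, Real.sin_pi_div_two]
  · have : Real.cos θ = 1 ∨ Real.cos θ = -1 := by
      exact mul_self_eq_one_iff.mp (by nlinarith)
    rcases this with hc | hc
    · exact hpow 0 (by simp [hc]) (by simp [hs])
    · have e : ((2 : ℕ) : ℝ) * (Real.pi / 2) = Real.pi := by push_cast; ring
      exact hpow 2 (by rw [e, hc, Real.cos_pi]) (by rw [e, hs, Real.sin_pi])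

/-- A rotation whose matrix is monomial is in the octahedral group. -/
theorem SO3.IsMonomial.mem_octahedralGroup {g : SO3} (hg : g.IsMonomial) :
    g ∈ octahedralGroup := by
  have key : ∀ (b : Fin 3) (g : SO3) (i : Fin 3), (rot b (Real.pi / 2) * g).1 i 0 =
      ∑ k, rotMatrix b (Real.pi / 2) i k * g.1 k 0 := fun b g i => Matrix.mul_apply
  have reduce : ∀ (b : Fin 3) (g : SO3), rot b (Real.pi / 2) * g ∈ octahedralGroup →
      g ∈ octahedralGroup := fun b g h =>
    (Subgroup.mul_mem_cancel_left _ (rot_mem_octahedralGroup b)).mp h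
  -- The corner entry is `1` or `-1`; two quarter turns around `z` correct the sign.
  have diag : ∀ g : SO3, g.IsMonomial → g.1 0 0 ≠ 0 → g ∈ octahedralGroup := by
    intro g hg h0
    rcases g.entry_eq_one_or 0 0 (fun j hj => (hg 0 j 0 hj).resolve_right h0) with h | h
    · exact hg.mem_of_one h
    · refine reduce 2 _ (reduce 2 _ ((hg.rot_mul 2).rot_mul 2 |>.mem_of_one ?_))
      rw [key, Fin.sum_univ_three, key, key, key]
      simp [rotMatrix, Fin.sum_univ_three, h]
  have hcol := g.sum_mul_col 0 0
  rw [Fin.sum_univ_three] at hcol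
  -- A quarter turn around `z` or `y` moves the nonzero entry of the first column to the top.
  by_cases h0 : g.1 0 0 = 0
  · by_cases h1 : g.1 1 0 = 0
    · have h2 : g.1 2 0 ≠ 0 := fun h2 => by simp [h0, h1, h2] at hcol
      refine reduce 1 _ (diag _ (hg.rot_mul 1) ?_)
      rw [key, Fin.sum_univ_three]
      simpa [rotMatrix] using h2
    · refine reduce 2 _ (diag _ (hg.rot_mul 2) ?_)
      rw [key, Fin.sum_univ_three]
      simpa [rotMatrix] using h1
  · exact diag g hg h0

end Rotations


/-! ### Tensor product operators as Kronecker matrices. -/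

section MatrixModel

open Matrix

variable {P : Type*} [Fintype P]

/-- The Kronecker product `⨂ₛ Aₛ` as a matrix indexed by the computational basis. -/
def kron (A : P → Matrix (Fin 2) (Fin 2) ℂ) : Matrix (P → Fin 2) (P → Fin 2) ℂ :=
  Matrix.of fun i j => ∏ s, A s (i s) (j s)

theorem kron_mul [DecidableEq P] (A B : P → Matrix (Fin 2) (Fin 2) ℂ) :
    kron A * kron B = kron fun s => A s * B s := by
  ext i j
  simp only [kron, Matrix.mul_apply, Matrix.of_apply, ← Finset.prod_mul_distrib]
  rw [Finset.prod_univ_sum, Fintype.piFinset_univ]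

theorem kron_one : kron (fun _ : P => 1) = 1 := by
  ext i j
  simp only [kron, Matrix.of_apply, Matrix.one_apply, Fintype.prod_ite_zero, Finset.prod_const_one,
    funext_iff]

theorem conjTranspose_kron (A : P → Matrix (Fin 2) (Fin 2) ℂ) :
    (kron A)ᴴ = kron fun s => (A s)ᴴ := by
  ext i j
  simp [kron, Matrix.conjTranspose_apply]

theorem trace_kron [DecidableEq P] (A : P → Matrix (Fin 2) (Fin 2) ℂ) :
    (kron A).trace = ∏ s, (A s).trace := by
  simp only [kron, Matrix.trace, Matrix.diag_apply, Matrix.of_apply]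
  rw [Finset.prod_univ_sum, Fintype.piFinset_univ]

/-- The computational basis identifies the operators on the state space with matrices. -/
noncomputable def opMatrix (P : Type*) [Fintype P] [DecidableEq P] :
    Module.End ℂ (StateSpace P) ≃ₐ[ℂ] Matrix (P → Fin 2) (P → Fin 2) ℂ :=
  LinearMap.toMatrixAlgEquiv (Basis.piTensorProduct fun _ : P => Pi.basisFun ℂ (Fin 2))

theorem opMatrix_localOp [DecidableEq P] (A : P → Matrix (Fin 2) (Fin 2) ℂ) :
    opMatrix P (localOp A) = kron A := by
  ext i j
  simp only [opMatrix, LinearMap.toMatrixAlgEquiv_apply, Basis.piTensorProduct_apply, localOp,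
    PiTensorProduct.map_tprod, Basis.piTensorProduct_repr_tprod_apply, kron, Matrix.of_apply]
  simp

end MatrixModel

/-! ### Pauli matrices, the trace form and the action of rotations. -/

section Pauli

open Matrix

theorem trace_sigma (i : Fin 3) : (sigma i).trace = 0 := by
  fin_cases i <;> simp [sigma, Matrix.trace]

theorem trace_sigma_mul_sigma (i j : Fin 3) :
    (sigma i * sigma j).trace = if i = j then 2 else 0 := by
  fin_cases i <;> fin_cases j <;> simp [sigma, Matrix.trace] <;> norm_num

/-- The coordinate axis of a nonzero vector of `V`. -/
def axis (v : V) : Fin 3 := if v = (1, 0) then 2 else if v = (0, 1) then 0 else 1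

theorem axis_injOn {v w : V} (hv : v ≠ 0) (hw : w ≠ 0) (h : axis v = axis w) : v = w := by
  revert v w
  decide

theorem axis_surj (i : Fin 3) : ∃ v : V, v ≠ 0 ∧ axis v = i := by
  revert i
  decide

theorem pauli_zero : pauli 0 = 1 := if_pos rfl

theorem pauli_of_ne {v : V} (h : v ≠ 0) : pauli v = sigma (axis v) := by
  unfold pauli axis
  rw [if_neg (show v ≠ (0, 0) from h)]
  split_ifs <;> rfl

theorem pauli_mul_self (v : V) : pauli v * pauli v = 1 := by
  by_cases h : v = 0
  · rw [h, pauli_zero, one_mul]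
  · rw [pauli_of_ne h]
    generalize axis v = k
    ext i j
    fin_cases k <;> fin_cases i <;> fin_cases j <;> simp [sigma, Matrix.mul_apply]

theorem conjTranspose_pauli (v : V) : (pauli v)ᴴ = pauli v := by
  by_cases h : v = 0
  · rw [h, pauli_zero, Matrix.conjTranspose_one]
  · rw [pauli_of_ne h]
    generalize axis v = k
    ext i j
    fin_cases k <;> fin_cases i <;> fin_cases j <;> simp [sigma]

/-- The matrix of `1 ⊕ g`, the action of a rotation on the span of all Pauli matrices. -/
noncomputable def adjointEntry (g : SO3) (b v : V) : ℂ :=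
  if b = 0 then if v = 0 then 1 else 0 else if v = 0 then 0 else (g.1 (axis b) (axis v) : ℂ)

theorem adjointEntry_of_ne (g : SO3) {b v : V} (hb : b ≠ 0) (hv : v ≠ 0) :
    adjointEntry g b v = (g.1 (axis b) (axis v) : ℂ) := by
  rw [adjointEntry, if_neg hb, if_neg hv]

theorem adjointEntry_eq_zero (g : SO3) {b v : V} (h : ¬(b = 0 ↔ v = 0)) :
    adjointEntry g b v = 0 := by
  unfold adjointEntry
  split_ifs <;> tauto

theorem herm_single (i : Fin 3) : herm (Pi.single i 1) = sigma i := by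
  simp [herm, Pi.single_apply]

theorem Represents.conj_sigma {u : Matrix.unitaryGroup (Fin 2) ℂ} {g : SO3} (h : Represents u g)
    (i : Fin 3) : u.1 * sigma i * u.1ᴴ = ∑ k, (g.1 k i : ℂ) • sigma k := by
  have := h (Pi.single i 1)
  rw [herm_single] at this
  rw [← Matrix.star_eq_conjTranspose, this]
  simp [herm]

/-- Conjugation fixes the identity and rotates the other Pauli matrices by `g`; since Pauli matrices
are orthogonal of square norm two for the trace form, the trace reads off an entry of `1 ⊕ g`. -/
theorem Represents.trace_eq {u : Matrix.unitaryGroup (Fin 2) ℂ} {g : SO3} (h : Represents u g)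
    (b v : V) : (pauli b * (u.1 * pauli v * u.1ᴴ)).trace = 2 * adjointEntry g b v := by
  have huu : u.1 * u.1ᴴ = 1 := Matrix.mem_unitaryGroup_iff.mp u.2
  by_cases hv : v = 0
  · subst hv
    rw [pauli_zero, mul_one, huu, mul_one]
    by_cases hb : b = 0
    · simp [hb, pauli_zero, adjointEntry]
    · simp [pauli_of_ne hb, trace_sigma, adjointEntry, hb]
  · rw [pauli_of_ne hv, h.conj_sigma]
    by_cases hb : b = 0
    · simp [hb, pauli_zero, adjointEntry, hv, trace_sigma, Matrix.trace_sum]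
    · simp only [adjointEntry_of_ne g hb hv, pauli_of_ne hb, Matrix.mul_sum, Matrix.trace_sum,
        Matrix.mul_smul, Matrix.trace_smul, trace_sigma_mul_sigma, smul_eq_mul]
      simp [mul_comm]

theorem trace_pauli_mul (b v : V) : (pauli b * pauli v).trace = 2 * if b = v then 1 else 0 := by
  by_cases hv : v = 0
  · by_cases hb : b = 0
    · simp [hb, hv, pauli_zero]
    · simp [hv, pauli_zero, hb, pauli_of_ne hb, trace_sigma]
  · by_cases hb : b = 0
    · simp [hb, pauli_zero, pauli_of_ne hv, trace_sigma, Ne.symm hv]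
    · rw [pauli_of_ne hb, pauli_of_ne hv, trace_sigma_mul_sigma]
      by_cases h : b = v
      · simp [h]
      · rw [if_neg h, if_neg fun h' => h (axis_injOn hb hv h'), mul_zero]

end Pauli


/-! ### Invariance of the code projector. -/

section Invariance

open Matrix

variable {P : Type*} {L : Submodule (ZMod 2) (P → V)}

/-- As `v + v = 0`, both `σ(v)` and the Pauli operator of `v` square to the identity, hence so does
the scalar between them. Real scalars make the sum of the stabilizers Hermitian. -/
theorem StabSection.exists_sign [Fintype P] [DecidableEq P] (σ : StabSection L) :
    ∃ c : L → ℂ, (∀ v, c v = 1 ∨ c v = -1) ∧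
      ∀ v, opMatrix P (σ.hom (Multiplicative.ofAdd v)) = c v • kron fun s => pauli (v.1 s) := by
  choose c hc using σ.isPauliOver
  have hop : ∀ v, opMatrix P (σ.hom (Multiplicative.ofAdd v)) =
      (c v : ℂ) • kron fun s => pauli (v.1 s) := fun v => by
    rw [hc, map_smul, opMatrix_localOp]
  refine ⟨fun v => (c v : ℂ), fun v => ?_, hop⟩
  have h1 : σ.hom (Multiplicative.ofAdd v) * σ.hom (Multiplicative.ofAdd v) = 1 := by
    rw [← map_mul, ← ofAdd_add, ZModModule.add_self, ofAdd_zero, map_one]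
  have h2 := congrArg (opMatrix P) h1
  rw [map_mul, map_one, hop, smul_mul_smul_comm, kron_mul] at h2
  simp only [pauli_mul_self] at h2
  rw [kron_one] at h2
  have h3 := congrFun (congrFun h2 fun _ => 0) fun _ => 0
  simp only [Matrix.smul_apply, Matrix.one_apply_eq, smul_eq_mul, mul_one] at h3
  exact mul_self_eq_one_iff.mp h3

/-- The sum of the stabilizer operators, a multiple of the projector onto the code. -/
noncomputable def StabSection.total [Fintype L] (σ : StabSection L) :
    Module.End ℂ (StateSpace P) :=
  ∑ v : Multiplicative L, σ.hom v

theorem StabSection.total_mem_code [Fintype L] (σ : StabSection L) (ψ : StateSpace P) :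
    σ.total ψ ∈ code σ := by
  simp only [code, Submodule.mem_iInf, LinearMap.mem_ker, LinearMap.sub_apply, sub_eq_zero]
  intro w
  rw [← Module.End.mul_apply, StabSection.total, Finset.mul_sum]
  simp only [← map_mul]
  rw [Fintype.sum_bijective (fun v => w * v) (Group.mulLeft_bijective w) (fun v => σ.hom (w * v))
    (fun v => σ.hom v) fun _ => rfl]
  rfl

theorem StabSection.total_apply_of_mem [Fintype L] (σ : StabSection L) {ψ : StateSpace P}
    (h : ψ ∈ code σ) : σ.total ψ = (Fintype.card L : ℂ) • ψ := by
  simp only [code, Submodule.mem_iInf, LinearMap.mem_ker, LinearMap.sub_apply, sub_eq_zero] at h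
  rw [StabSection.total, LinearMap.sum_apply, Finset.sum_congr rfl fun v _ => h v]
  simp [← Nat.cast_smul_eq_nsmul ℂ]

/-- The image of `total` lies in the code, the unitary keeps it there, and `total` acts on the code
as the scalar `|L|`. -/
theorem Preserves.total_mul [Fintype P] [Fintype L] {σ : StabSection L}
    {u : P → Matrix.unitaryGroup (Fin 2) ℂ} (h : Preserves σ u) :
    σ.total * (localOp (fun s => (u s).1) * σ.total) =
      (Fintype.card L : ℂ) • (localOp (fun s => (u s).1) * σ.total) :=
  LinearMap.ext fun ψ => σ.total_apply_of_mem (h _ (σ.total_mem_code ψ))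

/-- A local unitary that preserves the code commutes with the projector onto it. -/
theorem Preserves.commute [Fintype P] [DecidableEq P] [Fintype L] {σ : StabSection L}
    {u : P → Matrix.unitaryGroup (Fin 2) ℂ} (h : Preserves σ u) :
    kron (fun s => (u s).1) * opMatrix P σ.total = opMatrix P σ.total * kron fun s => (u s).1 := by
  obtain ⟨c, hc, hop⟩ := σ.exists_sign
  have hQ : (opMatrix P σ.total)ᴴ = opMatrix P σ.total := by
    rw [StabSection.total, map_sum, Matrix.conjTranspose_sum]
    refine Finset.sum_congr rfl fun v _ => ?_
    have := hop (Multiplicative.toAdd v)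
    rw [ofAdd_toAdd] at this
    rw [this, Matrix.conjTranspose_smul, conjTranspose_kron]
    simp only [conjTranspose_pauli]
    rcases hc (Multiplicative.toAdd v) with h | h <;> simp [h]
  have h1 := congrArg (opMatrix P) h.total_mul
  have h2 := congrArg (opMatrix P) h.inv.total_mul
  simp only [map_mul, map_smul, opMatrix_localOp] at h1 h2
  -- With `Q` the Hermitian sum and `W` the unitary, the relation for `W⁻¹` has the adjoint `Q W Q =
  -- |L| Q W`, while `h1` says `Q W Q = |L| W Q`.
  have h3 := congrArg Matrix.conjTranspose h2
  have hu : (kron fun s => ((u⁻¹) s).1)ᴴ = kron fun s => (u s).1 := by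
    rw [conjTranspose_kron]
    congr 1
    funext s
    exact Matrix.conjTranspose_conjTranspose _
  simp only [Matrix.conjTranspose_mul, Matrix.conjTranspose_smul, hQ, hu] at h3
  rw [star_natCast, Matrix.mul_assoc] at h3
  have hcard : (Fintype.card L : ℂ) ≠ 0 := Nat.cast_ne_zero.mpr Fintype.card_ne_zero
  exact smul_right_injective _ hcard (h1.symm.trans h3)

/-- The coefficients of the projector onto the code with respect to the Pauli operators are
invariant under the automorphisms of the code. -/
theorem exists_invariant_coeff [Fintype P] [DecidableEq P] [Fintype L] {σ : StabSection L} {g : P → SO3}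
    (hg : g ∈ autGroup σ) :
    ∃ c : L → ℂ, (∀ v, c v ≠ 0) ∧ ∀ b : P → V,
      ∑ v : L, c v * ∏ s, adjointEntry (g s) (b s) (v.1 s) =
        ∑ v : L, c v * ∏ s, if b s = v.1 s then 1 else 0 := by
  obtain ⟨u, hu, hpres⟩ := hg
  obtain ⟨c, hc, hop⟩ := σ.exists_sign
  refine ⟨c, fun v => ?_, fun b => ?_⟩
  · rcases hc v with h | h <;> simp [h]
  set W := kron fun s => (u s).1 with hW
  have hWW : W * Wᴴ = 1 := by
    rw [hW, conjTranspose_kron, kron_mul, ← kron_one]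
    congr 1
    funext s
    exact Matrix.mem_unitaryGroup_iff.mp (u s).2
  have hQ : opMatrix P σ.total = ∑ v : L, c v • kron fun s => pauli (v.1 s) := by
    rw [StabSection.total, map_sum]
    exact Fintype.sum_equiv Multiplicative.toAdd _ _ fun v => hop (Multiplicative.toAdd v)
  have hinv : W * opMatrix P σ.total * Wᴴ = opMatrix P σ.total := by
    rw [hpres.commute, Matrix.mul_assoc, hWW, Matrix.mul_one]
  -- The trace against the Pauli operator of `b` extracts its coefficient on both sides, up to a
  -- factor two for every qubit.
  have htr := congrArg (fun M => (kron (fun s => pauli (b s)) * M).trace) hinv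
  simp only [hQ, Matrix.mul_sum, Matrix.sum_mul, Matrix.trace_sum, Matrix.mul_smul,
    Matrix.smul_mul, Matrix.trace_smul, hW, conjTranspose_kron, kron_mul, trace_kron,
    (hu _).trace_eq, trace_pauli_mul, Finset.prod_mul_distrib, Finset.prod_const, smul_eq_mul,
    mul_left_comm (c _)] at htr
  rw [← Finset.mul_sum, ← Finset.mul_sum] at htr
  exact mul_left_cancel₀ (pow_ne_zero _ two_ne_zero) htr

/-- The columns of `1 ⊕ g` are orthonormal; this serves to move one `g p` across the invariance
equation. -/
theorem sum_adjointEntry_mul (g : SO3) (v w : V) :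
    ∑ b, adjointEntry g b v * adjointEntry g b w = if v = w then 1 else 0 := by
  have huniv : (Finset.univ : Finset V) = {0, (0, 1), (1, 1), (1, 0)} := by decide
  rw [huniv, Finset.sum_insert (by decide), Finset.sum_insert (by decide),
    Finset.sum_insert (by decide), Finset.sum_singleton]
  by_cases hv : v = 0
  · by_cases hw : w = 0
    · simp [hv, hw, adjointEntry]
    · simp [hv, hw, adjointEntry, Ne.symm hw]
  · by_cases hw : w = 0
    · simp [hv, hw, adjointEntry]
    · rw [adjointEntry_eq_zero g (v := v) (by tauto), zero_mul, zero_add]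
      rw [adjointEntry_of_ne g (by decide) hv, adjointEntry_of_ne g (by decide) hw,
        adjointEntry_of_ne g (by decide) hv, adjointEntry_of_ne g (by decide) hw,
        adjointEntry_of_ne g (by decide) hv, adjointEntry_of_ne g (by decide) hw]
      have := g.sum_mul_col (axis v) (axis w)
      rw [Fin.sum_univ_three] at this
      have h2 : axis (0, 1) = 0 ∧ axis (1, 1) = 1 ∧ axis (1, 0) = 2 := by decide
      rw [h2.1, h2.2.1, h2.2.2]
      have h3 : (axis v = axis w) = (v = w) :=
        propext ⟨axis_injOn hv hw, fun h => h ▸ rfl⟩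
      simp only [h3] at this
      have h4 := congrArg (Complex.ofReal) this
      split_ifs at h4 ⊢ <;> simpa [add_assoc] using h4

end Invariance


/-! ### Consequences of invariance for single coefficients. -/

section Coefficients

variable {P : Type*} [Fintype P] [DecidableEq P] {L : Submodule (ZMod 2) (P → V)}

theorem prod_update_eq (F : P → V → V → ℂ) (b v : P → V) (p : P) (β : V) :
    ∏ s, F s (Function.update b p β s) (v s) =
      F p β (v p) * ∏ s ∈ Finset.univ.erase p, F s (b s) (v s) := by
  rw [← Finset.mul_prod_erase _ _ (Finset.mem_univ p), Function.update_self]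
  congr 1
  refine Finset.prod_congr rfl fun s hs => ?_
  rw [Function.update_of_ne (Finset.ne_of_mem_erase hs)]

/-- If all vectors of `L` with the same support as `v₀` have the same entry at `p`, then every
automorphism preserves the corresponding axis at `p`. -/
theorem adjointEntry_eq_zero_of_common_value [Fintype L] {g : P → SO3} {c : L → ℂ}
    (hc : ∀ v, c v ≠ 0)
    (heq : ∀ b : P → V, ∑ v : L, c v * ∏ s, adjointEntry (g s) (b s) (v.1 s) =
        ∑ v : L, c v * ∏ s, if b s = v.1 s then 1 else 0)
    {v₀ : P → V} (hv₀ : v₀ ∈ L) {p : P} (hp : v₀ p ≠ 0)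
    (hsame : ∀ v ∈ L, (∀ s, v s = 0 ↔ v₀ s = 0) → v p = v₀ p) {β : V} (hβ : β ≠ v₀ p) :
    adjointEntry (g p) β (v₀ p) = 0 := by
  classical
  by_cases hβ0 : β = 0
  · exact adjointEntry_eq_zero _ (by tauto)
  -- `F` is what remains of the coefficient sum once the common factor at `p` is taken out; vectors
  -- of other supports contribute zero.
  set F : ℂ := ∑ v : L, if ∀ s, v.1 s = 0 ↔ v₀ s = 0 then
    c v * ∏ s ∈ Finset.univ.erase p, adjointEntry (g s) (v₀ s) (v.1 s) else 0 with hF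
  have hleft : ∀ γ : V, γ ≠ 0 → ∑ v : L, c v * ∏ s, adjointEntry (g s)
      (Function.update v₀ p γ s) (v.1 s) = adjointEntry (g p) γ (v₀ p) * F := by
    intro γ hγ
    rw [hF, Finset.mul_sum]
    refine Finset.sum_congr rfl fun v _ => ?_
    split_ifs with h
    · rw [prod_update_eq (fun s => adjointEntry (g s)), hsame v.1 v.2 h]
      ring
    · push Not at h
      obtain ⟨s, hs⟩ := h
      rw [Finset.prod_eq_zero (Finset.mem_univ s), mul_zero, mul_zero]
      refine adjointEntry_eq_zero _ fun h' => ?_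
      by_cases hsp : s = p
      · subst hsp
        rw [Function.update_self] at h'
        tauto
      · rw [Function.update_of_ne hsp] at h'
        tauto
  -- At `v₀` itself the right side is `c v₀ ≠ 0`, whence `F ≠ 0`. With `β` at `p` the right side is
  -- zero: such a vector in `L` would have the support of `v₀` but another entry at `p`.
  have h1 := heq (Function.update v₀ p (v₀ p))
  rw [hleft _ hp, Function.update_eq_self] at h1
  simp only [Fintype.prod_ite_zero, ← funext_iff, Finset.prod_const_one] at h1
  rw [Finset.sum_eq_single (⟨v₀, hv₀⟩ : L)
    (fun v _ hv => by rw [if_neg fun h => hv (Subtype.ext h.symm), mul_zero]) (by simp),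
    if_pos rfl, mul_one] at h1
  have hF0 : F ≠ 0 := fun h => hc ⟨v₀, hv₀⟩ (by rw [← h1, h, mul_zero])
  have h2 := heq (Function.update v₀ p β)
  rw [hleft _ hβ0] at h2
  simp only [Fintype.prod_ite_zero, ← funext_iff, Finset.prod_const_one] at h2
  rw [Finset.sum_eq_zero fun v _ => ?_] at h2
  · exact (mul_eq_zero.mp h2).resolve_right hF0
  · rw [if_neg, mul_zero]
    intro h
    have hvp : v.1 p = β := by rw [← h, Function.update_self]
    refine hβ (hvp ▸ hsame v.1 v.2 fun s => ?_)
    rw [← h]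
    by_cases hsp : s = p
    · subst hsp
      rw [Function.update_self]
      tauto
    · rw [Function.update_of_ne hsp]

/-- Apply the transpose, that is the inverse, of `1 ⊕ g p` at the factor `p` only. The left side
then retains just the vectors with entry `α` at `p`. -/
theorem contracted_invariance [Fintype L] {g : P → SO3} {c : L → ℂ}
    (heq : ∀ b : P → V, ∑ v : L, c v * ∏ s, adjointEntry (g s) (b s) (v.1 s) =
        ∑ v : L, c v * ∏ s, if b s = v.1 s then 1 else 0) (b : P → V) (p : P) (α : V) :
    ∑ v : L, c v * ((if α = v.1 p then 1 else 0) *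
        ∏ s ∈ Finset.univ.erase p, adjointEntry (g s) (b s) (v.1 s)) =
      ∑ v : L, c v * (adjointEntry (g p) (v.1 p) α *
        ∏ s ∈ Finset.univ.erase p, if b s = v.1 s then 1 else 0) := by
  have h : ∑ β, adjointEntry (g p) β α * ∑ v : L, c v * ∏ s, adjointEntry (g s)
      (Function.update b p β s) (v.1 s) = ∑ β, adjointEntry (g p) β α *
        ∑ v : L, c v * ∏ s, if Function.update b p β s = v.1 s then 1 else 0 :=
    Finset.sum_congr rfl fun β _ => by rw [heq]
  simp only [prod_update_eq (fun s => adjointEntry (g s)),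
    prod_update_eq (fun _ x y => if x = y then 1 else 0), Finset.mul_sum] at h
  rw [Finset.sum_comm, Finset.sum_comm (γ := V)] at h
  convert h using 2 with v _ v _
  · rw [← sum_adjointEntry_mul (g p), Finset.sum_mul, Finset.mul_sum]
    exact Finset.sum_congr rfl fun β _ => by ring
  · rw [Finset.sum_eq_single (v.1 p) (fun β _ hβ => by rw [if_neg hβ]; ring) (by simp), if_pos rfl]
    ring

end Coefficients

/-! ### Subspaces `L_S` whose nonzero vectors have full support. -/

section FullSupport

variable {P : Type*} {L : Submodule (ZMod 2) (P → V)} {S : Finset P}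

/-- Otherwise the difference would be a nonzero vector with a zero entry in `S`. -/
theorem eq_of_apply_eq (hfull : ∀ u ∈ restrict L S, u ≠ 0 → ∀ s ∈ S, u s ≠ 0) {u v : P → V}
    (hu : u ∈ restrict L S) (hv : v ∈ restrict L S) {s : P} (hs : s ∈ S) (h : u s = v s) :
    u = v := by
  by_contra hne
  exact hfull (u - v) (Submodule.sub_mem _ hu hv) (sub_ne_zero.mpr hne) s hs
    (by rw [Pi.sub_apply, h, sub_self])

/-- If the nonzero vectors of `L_S` have full support, if `L_S` projects onto the factor at `p`
and if `S` has at least three elements, then every automorphism is monomial at `p`. -/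
theorem adjointEntry_monomial [Fintype P] [DecidableEq P] [Fintype L] {g : P → SO3} {c : L → ℂ} (hc : ∀ v, c v ≠ 0)
    (heq : ∀ b : P → V, ∑ v : L, c v * ∏ s, adjointEntry (g s) (b s) (v.1 s) =
        ∑ v : L, c v * ∏ s, if b s = v.1 s then 1 else 0)
    (hfull : ∀ u ∈ restrict L S, u ≠ 0 → ∀ s ∈ S, u s ≠ 0) {p q r : P}
    (hsurj : ∀ α, ∃ u ∈ restrict L S, u p = α) (hp : p ∈ S) (hq : q ∈ S) (hr : r ∈ S)
    (hpq : q ≠ p) (hpr : r ≠ p) (hqr : q ≠ r) (α : V) {β β' : V} (hβ : β ≠ β') :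
    adjointEntry (g p) β α = 0 ∨ adjointEntry (g p) β' α = 0 := by
  obtain ⟨w, hw, rfl⟩ := hsurj α
  -- Only `w` survives: another vector with entry `w p` at `p` is nonzero somewhere outside `S`,
  -- where `b` vanishes. So the left side is a pure tensor in `b`.
  have hleft : ∀ b : P → V, (∀ s, s ∉ S → b s = 0) →
      ∑ v : L, c v * ((if w p = v.1 p then 1 else 0) *
        ∏ s ∈ Finset.univ.erase p, adjointEntry (g s) (b s) (v.1 s)) =
      c ⟨w, hw.1⟩ * ∏ s ∈ Finset.univ.erase p, adjointEntry (g s) (b s) (w s) := by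
    intro b hb
    rw [Finset.sum_eq_single (⟨w, hw.1⟩ : L) (fun u _ hu => ?_) (by simp), if_pos rfl, one_mul]
    by_cases hup : w p = u.1 p
    · have hmem : u.1 ∉ restrict L S := fun h =>
        hu (Subtype.ext (eq_of_apply_eq hfull h hw hp hup.symm))
      have : ∃ s, s ∉ S ∧ u.1 s ≠ 0 := by
        by_contra! h
        exact hmem ⟨u.2, h⟩
      obtain ⟨s, hs, hus⟩ := this
      rw [Finset.prod_eq_zero (i := s), mul_zero, mul_zero]
      · simp only [Finset.mem_erase, Finset.mem_univ, and_true]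
        rintro rfl
        exact hs hp
      · exact adjointEntry_eq_zero _ (by simp [hb s hs, hus])
    · rw [if_neg hup, zero_mul, mul_zero]
  have hmem : ∀ b : P → V, (∀ s, s ∉ S → b s = 0) → ∀ u : L,
      (∀ s ∈ Finset.univ.erase p, b s = u.1 s) → u.1 ∈ restrict L S := by
    intro b hb u h
    refine ⟨u.2, fun s hs => ?_⟩
    rw [← h s (by simpa using fun h : s = p => hs (h ▸ hp)), hb s hs]
  -- At `b = v` the right side has the single term of `v`, because the entry at `q` determines a
  -- vector of `L_S`. If it is nonzero, so is every factor on the left.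
  have hne : ∀ v ∈ restrict L S, adjointEntry (g p) (v p) (w p) ≠ 0 →
      ∀ s ∈ Finset.univ.erase p, adjointEntry (g s) (v s) (w s) ≠ 0 := by
    intro v hv hvw
    have h := contracted_invariance heq v p (w p)
    rw [hleft v hv.2, Finset.sum_eq_single (⟨v, hv.1⟩ : L) (fun u _ hu => ?_) (by simp)] at h
    · simp only [if_true, Finset.prod_const_one, mul_one] at h
      have := mul_ne_zero (hc ⟨v, hv.1⟩) hvw
      rw [← h] at this
      exact Finset.prod_ne_zero_iff.mp (right_ne_zero_of_mul this)
    · rw [Finset.prod_ite_zero, if_neg, mul_zero, mul_zero]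
      intro h
      exact hu (Subtype.ext (eq_of_apply_eq hfull (hmem v hv.2 u h) hv hq
        (h q (by simpa using hpq)).symm))
  by_contra! hcon
  -- Mix the two vectors: `v'` at `q`, `v` elsewhere. The pure tensor on the left stays nonzero, but
  -- no vector of `L_S` agrees with `v` at `r` and with `v'` at `q`. Here the third element of `S`
  -- is needed.
  obtain ⟨v, hv, rfl⟩ := hsurj β
  obtain ⟨v', hv', rfl⟩ := hsurj β'
  have hb : ∀ s, s ∉ S → Function.update v q (v' q) s = 0 := by
    intro s hs
    rw [Function.update_of_ne (by rintro rfl; exact hs hq), hv.2 s hs]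
  have h := contracted_invariance heq (Function.update v q (v' q)) p (w p)
  rw [hleft _ hb, Finset.sum_eq_zero fun u _ => ?_] at h
  · refine mul_ne_zero (hc _) (Finset.prod_ne_zero_iff.mpr fun s hs => ?_) h
    by_cases hsq : s = q
    · subst hsq
      rw [Function.update_self]
      exact hne v' hv' hcon.2 s hs
    · rw [Function.update_of_ne hsq]
      exact hne v hv hcon.1 s hs
  · rw [Finset.prod_ite_zero, if_neg, mul_zero, mul_zero]
    intro h
    have hu := hmem _ hb u h
    have h1 := h q (by simpa using hpq)
    have h2 := h r (by simpa using hpr)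
    rw [Function.update_self] at h1
    rw [Function.update_of_ne hqr.symm] at h2
    exact hβ (congrFun ((eq_of_apply_eq hfull hv hu hr h2).trans
      (eq_of_apply_eq hfull hv' hu hq h1).symm) p)

theorem exists_pair {p : P} (hsurj : ∀ α, ∃ u ∈ restrict L S, u p = α) :
    ∃ v ∈ restrict L S, ∃ w ∈ restrict L S, v ≠ 0 ∧ w ≠ 0 ∧ v ≠ w := by
  obtain ⟨v, hv, hvp⟩ := hsurj (1, 0)
  obtain ⟨w, hw, hwp⟩ := hsurj (0, 1)
  refine ⟨v, hv, w, hw, ?_, ?_, ?_⟩ <;> rintro rfl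
  · exact absurd (show (0 : V) = (1, 0) from hvp) (by decide)
  · exact absurd (show (0 : V) = (0, 1) from hwp) (by decide)
  · exact absurd (hvp.symm.trans hwp) (by decide)

/-- Two distinct nonzero vectors of `L_S` have distinct nonzero entries at each element of `S`, so
every factor contributes `1` to their form, which is zero by isotropy. -/
theorem even_card_of_full [Fintype P] (hL : IsIsotropic L)
    (hfull : ∀ u ∈ restrict L S, u ≠ 0 → ∀ s ∈ S, u s ≠ 0) {p : P}
    (hsurj : ∀ α, ∃ u ∈ restrict L S, u p = α) : Even S.card := by
  obtain ⟨v, hv, w, hw, hv0, hw0, hvw⟩ := exists_pair hsurj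
  have key : ∀ a b : V, a ≠ 0 → b ≠ 0 → a ≠ b → a.1 * b.2 - a.2 * b.1 = 1 := by decide
  have h := hL v hv.1 w hw.1
  rw [omega, ← Finset.sum_subset (Finset.subset_univ S)
    (fun s _ hs => by rw [hv.2 s hs]; simp), Finset.sum_congr rfl fun s hs =>
    key _ _ (hfull v hv hv0 s hs) (hfull w hw hw0 s hs)
      fun h => hvw (eq_of_apply_eq hfull hv hw hs h)] at h
  rw [Finset.sum_const, nsmul_one, ZMod.natCast_eq_zero_iff_even] at h
  exact h

/-- Subtract from `u ∈ L` the vector of `L_S` with the same entry at `p`. Within `S` the difference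
can only live at the other element `q`; being orthogonal to `L_S`, which fills `V` at `q`, it
vanishes there too. Indecomposability holds as full support leaves only zero in a proper subset of
`S`. -/
theorem splitsOffBell_of_card_eq_two [Fintype P] [DecidableEq P] (hL : IsIsotropic L)
    (hfull : ∀ u ∈ restrict L S, u ≠ 0 → ∀ s ∈ S, u s ≠ 0) {p : P}
    (hsurj : ∀ α, ∃ u ∈ restrict L S, u p = α) (hp : p ∈ S) (hcard : S.card = 2) :
    SplitsOffBell L := by
  obtain ⟨v, hv, w, hw, hv0, hw0, hvw⟩ := exists_pair hsurj
  refine ⟨S, ?_, hcard, ⟨inf_le_right, fun a ha b hb => hL a ha.1 b hb.1, ?_⟩, ?_⟩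
  · obtain ⟨q, hq⟩ : ∃ q, S.erase p = {q} :=
      Finset.card_eq_one.mp (by rw [Finset.card_erase_of_mem hp, hcard])
    have hqS : q ∈ S.erase p := hq ▸ Finset.mem_singleton_self q
    refine le_antisymm (fun u hu => ?_) (sup_le inf_le_left inf_le_left)
    obtain ⟨m, hm, hmp⟩ := hsurj (u p)
    have hd : u - m ∈ L := Submodule.sub_mem _ hu hm.1
    have hform : ∀ x ∈ restrict L S, ((u - m) q).1 * (x q).2 - ((u - m) q).2 * (x q).1 = 0 := by
      intro x hx
      have h := hL _ hd x hx.1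
      rw [omega, Finset.sum_eq_single q (fun s _ hs => ?_) (by simp)] at h
      · exact h
      · by_cases hsp : s = p
        · simp [hsp, hmp]
        · have : s ∉ S := fun hsS => hs (by
            have : s ∈ S.erase p := Finset.mem_erase.mpr ⟨hsp, hsS⟩
            rwa [hq, Finset.mem_singleton] at this)
          rw [hx.2 s this]
          simp
    have key : ∀ t a b : V, a ≠ 0 → b ≠ 0 → a ≠ b → t.1 * a.2 - t.2 * a.1 = 0 →
        t.1 * b.2 - t.2 * b.1 = 0 → t = 0 := by decide
    have hqS' := Finset.mem_of_mem_erase hqS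
    have hdq := key _ _ _ (hfull v hv hv0 q hqS') (hfull w hw hw0 q hqS')
      (fun h => hvw (eq_of_apply_eq hfull hv hw hqS' h)) (hform v hv) (hform w hw)
    refine Submodule.mem_sup.mpr ⟨m, hm, u - m, ⟨hd, fun s hs => ?_⟩, add_sub_cancel _ _⟩
    rw [Finset.notMem_compl] at hs
    by_cases hsp : s = p
    · simp [hsp, hmp]
    · have : s ∈ S.erase p := Finset.mem_erase.mpr ⟨hsp, hs⟩
      rw [hq, Finset.mem_singleton] at this
      rw [this, hdq]
  · let e : restrict L S →ₗ[ZMod 2] V := (LinearMap.proj p).comp (restrict L S).subtype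
    have he : Function.Bijective e :=
      ⟨fun a b h => Subtype.ext (eq_of_apply_eq hfull a.2 b.2 hp h),
        fun α => let ⟨u, hu, h⟩ := hsurj α; ⟨⟨u, hu⟩, h⟩⟩
    rw [(LinearEquiv.ofBijective e he).finrank_eq, hcard, Module.finrank_prod,
      Module.finrank_self]
  · have hbot : ∀ T ⊆ S, T ≠ S → restrict (restrict L S) T = ⊥ := by
      intro T hTS hT
      obtain ⟨s, hs, hsT⟩ := Finset.exists_of_ssubset (hTS.ssubset_of_ne hT)
      refine (Submodule.eq_bot_iff _).mpr fun u hu => ?_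
      by_contra h
      exact hfull u hu.1 h s hs (hu.2 s hsT)
    intro T hTS hT hne h
    obtain ⟨t, ht⟩ := hT
    rw [hbot T hTS hne, hbot (S \ T) Finset.sdiff_subset
      (fun h' => (Finset.mem_sdiff.mp (h'.symm ▸ hTS ht)).2 ht), sup_bot_eq] at h
    rw [h] at hv
    exact hv0 hv

/-- If two vectors with minimal support through `p` differ at `p`, then all nonzero vectors of
`L_S` have full support. -/
theorem full_of_minimal {p : P}
    (hmin : ∀ u ∈ restrict L S, u p ≠ 0 → ∀ s ∈ S, u s ≠ 0) {v w : P → V}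
    (hv : v ∈ restrict L S) (hw : w ∈ restrict L S) (hvp : v p ≠ 0) (hwp : w p ≠ 0)
    (hvw : v p ≠ w p) : ∀ u ∈ restrict L S, u ≠ 0 → ∀ s ∈ S, u s ≠ 0 := by
  intro u hu hu0
  by_cases hup : u p = 0
  · exfalso
    obtain ⟨t, ht⟩ := Function.ne_iff.mp hu0
    have htS : t ∈ S := by
      by_contra h
      exact ht (hu.2 t h)
    -- Subtracting `x` from `u` keeps a nonzero entry at `p`, so minimality forbids a zero at `t`.
    -- But `v`, `w` and `v + w` take all three nonzero values of `V` at `t`, leaving none for `u t`.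
    have hshift : ∀ x ∈ restrict L S, x p ≠ 0 → u t ≠ x t := fun x hx hxp h =>
      hmin (u - x) (Submodule.sub_mem _ hu hx) (by simpa [hup] using hxp) t htS
        (by rw [Pi.sub_apply, h, sub_self])
    have hadd : (v + w) p ≠ 0 := by
      have : ∀ a b : V, a ≠ b → a + b ≠ 0 := by decide
      exact this _ _ hvw
    have key : ∀ a b x : V, a ≠ 0 → b ≠ 0 → a + b ≠ 0 → x ≠ 0 → x ≠ a → x ≠ b → x = a + b := by
      decide
    have hvwS := Submodule.add_mem _ hv hw
    exact hshift _ hvwS hadd (key _ _ _ (hmin v hv hvp t htS) (hmin w hw hwp t htS)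
      (hmin _ hvwS hadd t htS) ht (hshift v hv hvp) (hshift w hw hwp))
  · exact hmin u hu hup

theorem surjective_of_two_values {p : P} {v w : P → V}
    (hv : v ∈ restrict L S) (hw : w ∈ restrict L S) (hvp : v p ≠ 0) (hwp : w p ≠ 0)
    (hvw : v p ≠ w p) (α : V) : ∃ u ∈ restrict L S, u p = α := by
  have key : ∀ a b x : V, a ≠ 0 → b ≠ 0 → a ≠ b → x ≠ 0 → x ≠ a → x ≠ b → x = a + b := by
    decide
  by_cases h0 : α = 0
  · exact ⟨0, Submodule.zero_mem _, h0.symm⟩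
  by_cases h1 : α = v p
  · exact ⟨v, hv, h1.symm⟩
  by_cases h2 : α = w p
  · exact ⟨w, hw, h2.symm⟩
  exact ⟨v + w, Submodule.add_mem _ hv hw, (key _ _ α hvp hwp hvw h0 h1 h2).symm⟩

/-- If `L` splits off no zero factor, there is a vector in `L` whose support is minimal among
those that contain `p`. -/
theorem exists_minimal_support [Fintype P] [DecidableEq P] (hzero : ¬ SplitsOffZero L) (p : P) :
    ∃ v ∈ L, v p ≠ 0 ∧ ∀ u ∈ L, u p ≠ 0 → (∀ s, v s = 0 → u s = 0) →
      ∀ s, v s ≠ 0 → u s ≠ 0 := by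
  classical
  have hex : ∃ v ∈ L, v p ≠ 0 := by
    -- If all of `L` vanished at `p`, then `{p}` would be a zero factor.
    by_contra! h
    refine hzero ⟨{p}, Finset.singleton_nonempty p, ?_, ?_⟩
    · refine le_antisymm (le_trans ?_ le_sup_right) (sup_le inf_le_left inf_le_left)
      refine fun v hv => ⟨hv, fun s hs => ?_⟩
      rw [Finset.notMem_compl, Finset.mem_singleton] at hs
      rw [hs, h v hv]
    · refine (Submodule.eq_bot_iff _).mpr fun v hv => funext fun s => ?_
      by_cases hs : s = p
      · rw [hs, h v hv.1]
        rfl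
      · exact hv.2 s (by simpa using hs)
  obtain ⟨x, hx, hxp⟩ := hex
  obtain ⟨v, hv, hvmin⟩ := Finset.exists_min_image
    (Finset.univ.filter fun v : P → V => v ∈ L ∧ v p ≠ 0)
    (fun v => (Finset.univ.filter fun s => v s ≠ 0).card) ⟨x, by simp [hx, hxp]⟩
  simp only [Finset.mem_filter, Finset.mem_univ, true_and] at hv hvmin
  refine ⟨v, hv.1, hv.2, fun u hu hup hsub s hs => ?_⟩
  have heq := Finset.eq_of_subset_of_card_le (fun t ht => by
    simp only [Finset.mem_filter, Finset.mem_univ, true_and] at ht ⊢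
    exact fun h => ht (hsub t h)) (hvmin u ⟨hu, hup⟩)
  have : s ∈ Finset.univ.filter fun s => u s ≠ 0 := by
    rw [heq]
    simpa using hs
  simpa using this

end FullSupport

end StabilizerCode

/-! ### The theorem. -/

theorem mainTheorem1 {P : Type*} [Fintype P] [DecidableEq P]
    (L : Submodule (ZMod 2) (P → StabilizerCode.V))
    (hL : StabilizerCode.IsIsotropic L)
    (hzero : ¬ StabilizerCode.SplitsOffZero L)
    (hbell : ¬ StabilizerCode.SplitsOffBell L)
    (p : P) :
    (∀ σ : StabilizerCode.StabSection L,
        StabilizerCode.autGroupAt σ p ≤ StabilizerCode.octahedralGroup) ∨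
      ∃ a : Fin 3, ∀ σ : StabilizerCode.StabSection L,
        StabilizerCode.autGroupAt σ p ≤ StabilizerCode.dihedralGroup a := by
  classical
  obtain ⟨v, hv, hvp, hmin⟩ := StabilizerCode.exists_minimal_support hzero p
  -- The case and the axis depend on `L` alone, so they serve all sections `σ` at once.
  by_cases hsame : ∀ w ∈ L, (∀ s, w s = 0 ↔ v s = 0) → w p = v p
  · refine Or.inr ⟨StabilizerCode.axis (v p), fun σ => ?_⟩
    rintro _ ⟨g, hg, rfl⟩
    obtain ⟨c, hc, heq⟩ := StabilizerCode.exists_invariant_coeff hg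
    refine StabilizerCode.mem_dihedralGroup _ _ fun j hj => ?_
    obtain ⟨β, hβ, rfl⟩ := StabilizerCode.axis_surj j
    have h := StabilizerCode.adjointEntry_eq_zero_of_common_value hc heq hv hvp hsame
      (β := β) fun h => hj (h ▸ rfl)
    rw [StabilizerCode.adjointEntry_of_ne _ hβ hvp] at h
    exact Complex.ofReal_eq_zero.mp h
  · push Not at hsame
    obtain ⟨w, hw, hwv, hne⟩ := hsame
    refine Or.inl fun σ => ?_
    rintro _ ⟨g, hg, rfl⟩
    obtain ⟨c, hc, heq⟩ := StabilizerCode.exists_invariant_coeff hg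
    set S : Finset P := Finset.univ.filter fun s => v s ≠ 0 with hS
    have hmemS : ∀ s, s ∈ S ↔ v s ≠ 0 := fun s => by simp [hS]
    have hp : p ∈ S := (hmemS p).mpr hvp
    have hwp : w p ≠ 0 := fun h => hvp ((hwv p).mp h)
    have hvS : v ∈ StabilizerCode.restrict L S :=
      ⟨hv, fun s hs => not_not.mp fun h => hs ((hmemS s).mpr h)⟩
    have hwS : w ∈ StabilizerCode.restrict L S :=
      ⟨hw, fun s hs => (hwv s).mpr (not_not.mp fun h => hs ((hmemS s).mpr h))⟩
    have hfull := StabilizerCode.full_of_minimal (fun u hu hup s hs =>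
      hmin u hu.1 hup (fun t ht => hu.2 t fun h => (hmemS t).mp h ht) s ((hmemS s).mp hs))
      hvS hwS hvp hwp hne.symm
    have hsurj := StabilizerCode.surjective_of_two_values hvS hwS hvp hwp hne.symm
    have hcard2 : S.card ≠ 2 := fun h =>
      hbell (StabilizerCode.splitsOffBell_of_card_eq_two hL hfull hsurj hp h)
    have heven := StabilizerCode.even_card_of_full hL hfull hsurj
    have hpos : 0 < S.card := Finset.card_pos.mpr ⟨p, hp⟩
    -- `|S|` is even, positive and not two, hence at least four.
    obtain ⟨q, hq, r, hr, hqr⟩ : ∃ q ∈ S.erase p, ∃ r ∈ S.erase p, q ≠ r := by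
      refine Finset.one_lt_card.mp ?_
      rw [Finset.card_erase_of_mem hp]
      obtain ⟨k, hk⟩ := heven
      omega
    rw [Finset.mem_erase] at hq hr
    refine StabilizerCode.SO3.IsMonomial.mem_octahedralGroup fun a i j hij => ?_
    obtain ⟨α, hα, rfl⟩ := StabilizerCode.axis_surj a
    obtain ⟨β, hβ, rfl⟩ := StabilizerCode.axis_surj i
    obtain ⟨β', hβ', rfl⟩ := StabilizerCode.axis_surj j
    have h := StabilizerCode.adjointEntry_monomial hc heq hfull hsurj hp hq.2 hr.2 hq.1 hr.1 hqr α
      (β := β) (β' := β') fun h => hij (h ▸ rfl)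
    rw [StabilizerCode.adjointEntry_of_ne _ hβ hα, StabilizerCode.adjointEntry_of_ne _ hβ' hα,
      Complex.ofReal_eq_zero, Complex.ofReal_eq_zero] at h
    exact h
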